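/- For a finite group $G$, let $\mathrm{Z}\ell^1(G)$ be the centre of the complex group algebra of $G$, with the norm $\|f\|_1=\sum_{g\in G}|f(g)|$. A diagonal element of a unital algebra $A$ is an $M\in A\otimes A$ such that $a\cdot M=M\cdot a$ for all $a\in A$ and such that multiplication $A\otimes A\to A$ maps $M$ to $1_A$. The algebra $\mathrm{Z}\ell^1(G)$ has a unique diagonal element; its norm in the projective tensor product $\mathrm{Z}\ell^1(G)\mathbin{\widehat\otimes}\mathrm{Z}\ell^1(G)$ is the ZL-amenability constant $\mathrm{AM}_{\mathrm Z}(G)$. A finite group has two character degrees if it is non-abelian and all its non-linear irreducible complex characters have the same degree. Let $q\ge 5$ be an odd prime power, let $\mathbb F_q$ be a field with $q$ elements, and let $G_q=\left\{\begin{pmatrix}a^2&b\\0&1\end{pmatrix}: a\in\mathbb F_q^\times,\ b\in\mathbb F_q\right\}$, a subgroup of the affine group $\mathrm{Aff}(\mathbb F_q)$. Then $G_q$ has two character degrees and $$\mathrm{AM}_{\mathrm Z}(G_q)=1+\frac{q+1}{2}\left(1-\frac{9}{q^2}\right).$$ Consequently, the ZL-amenability constants of finite groups with two character degrees are unbounded: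 for every real $C$ there is a finite group $G$ with two character degrees and $\mathrm{AM}_{\mathrm Z}(G)>C$. -/

import Mathlib

open scoped TensorProduct

/-! ### Diagonal elements and amenability constants -/

/-- `M ∈ A ⊗ A` is a diagonal element (separability idempotent) of the unital algebra `A`:
`a · M = M · a` for all `a`, where `a · (b ⊗ c) = (a b) ⊗ c` and `(b ⊗ c) · a = b ⊗ (c a)`, and
the multiplication map sends `M` to `1`. -/
def IsDiagonalElement (A : Type*) [Ring A] [Algebra ℂ A] (M : A ⊗[ℂ] A) : Prop :=
  (∀ a : A, (a ⊗ₜ[ℂ] (1 : A)) * M = M * ((1 : A) ⊗ₜ[ℂ] a)) ∧ LinearMap.mul' ℂ A M = 1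

/-- A commutative algebra has at most one diagonal element. -/
theorem IsDiagonalElement.unique {A : Type*} [CommRing A] [Algebra ℂ A] {M M' : A ⊗[ℂ] A}
    (h : IsDiagonalElement A M) (h' : IsDiagonalElement A M') : M = M' := by
  have key : ∀ N : A ⊗[ℂ] A, IsDiagonalElement A N → ∀ t : A ⊗[ℂ] A,
      t * N = (LinearMap.mul' ℂ A t ⊗ₜ[ℂ] (1 : A)) * N := by
    intro N hN t
    induction t with
    | zero => simp
    | add x y hx hy => rw [add_mul, hx, hy, map_add, TensorProduct.add_tmul, add_mul]
    | tmul a b =>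
      have e1 : a ⊗ₜ[ℂ] b = (a ⊗ₜ[ℂ] (1 : A)) * ((1 : A) ⊗ₜ[ℂ] b) := by simp
      have e2 : LinearMap.mul' ℂ A (a ⊗ₜ[ℂ] b) ⊗ₜ[ℂ] (1 : A)
          = (a ⊗ₜ[ℂ] (1 : A)) * (b ⊗ₜ[ℂ] (1 : A)) := by simp
      rw [e2, e1, mul_assoc, mul_assoc, hN.1 b, mul_comm N]
  have h1 := key M h M'
  have h2 := key M' h' M
  rw [h'.2, ← Algebra.TensorProduct.one_def, one_mul] at h1
  rw [h.2, ← Algebra.TensorProduct.one_def, one_mul] at h2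
  rw [← h1, mul_comm, h2]

/-- The projective tensor norm on `V ⊗ V`, where `V` is normed by `N`: the infimum of
`∑ i, N (a i) * N (b i)` over all representations `x = ∑ i, a i ⊗ b i`. -/
noncomputable def projectiveTensorNorm {V : Type*} [AddCommGroup V] [Module ℂ V] (N : V → ℝ)
    (x : V ⊗[ℂ] V) : ℝ :=
  sInf {r : ℝ | ∃ (n : ℕ) (a b : Fin n → V),
    x = ∑ i, a i ⊗ₜ[ℂ] b i ∧ r = ∑ i, N (a i) * N (b i)}

/-- The amenability constant of a finite-dimensional algebra `A` normed by `N`: the infimum of the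
projective tensor norms of its diagonal elements. (When `A` is commutative there is at most one
diagonal element, so for an amenable `A` this is the norm of the unique diagonal element.) -/
noncomputable def amenabilityConstant (A : Type*) [Ring A] [Algebra ℂ A] (N : A → ℝ) : ℝ :=
  sInf {r : ℝ | ∃ M : A ⊗[ℂ] A, IsDiagonalElement A M ∧ r = projectiveTensorNorm N M}

/-! ### The ZL-amenability constant of a finite group -/

/-- The `ℓ¹`-norm `∑ g, ‖f g‖` on the group algebra, `G` carrying counting measure. -/
noncomputable def l1Norm {G : Type*} [Group G] (f : MonoidAlgebra ℂ G) : ℝ :=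
  f.coeff.sum fun _ c => ‖c‖

/-- The ZL-amenability constant of a finite group `G`: the amenability constant of the centre of
the group algebra `ℓ¹(G)`, with the `ℓ¹`-norm. -/
noncomputable def zlAmenabilityConstant (G : Type*) [Group G] [Finite G] : ℝ :=
  amenabilityConstant (Subalgebra.center ℂ (MonoidAlgebra ℂ G)) fun f => l1Norm f.1

/-! ### Groups with two character degrees -/

/-- `χ` is a complex irreducible character of the finite group `G`, that is, the character of an
irreducible representation on some `ℂⁿ`. -/
def IsIrreducibleCharacter {G : Type*} [Group G] (χ : G → ℂ) : Prop :=
  ∃ (n : ℕ) (ρ : Representation ℂ G (Fin n → ℂ)), ρ.IsIrreducible ∧ χ = ρ.character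

/-- A character is linear if it is a homomorphism from `G` to the circle group. -/
def IsLinearCharacter {G : Type*} [Group G] (χ : G → ℂ) : Prop :=
  ∃ φ : G →* Circle, ∀ g, χ g = (φ g : ℂ)

/-- `G` has two character degrees: it is non-abelian, and all non-linear irreducible characters
have the same degree `χ 1`. -/
def HasTwoCharacterDegrees (G : Type*) [Group G] : Prop :=
  (∃ a b : G, a * b ≠ b * a) ∧
    ∀ χ ψ : G → ℂ, IsIrreducibleCharacter χ → IsIrreducibleCharacter ψ →
      ¬ IsLinearCharacter χ → ¬ IsLinearCharacter ψ → χ 1 = ψ 1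

/-! ### Affine groups -/

/-- The affine group of the field `F`: the matrices `(a b; 0 1)` with `a ≠ 0`. -/
def affineGroup (F : Type*) [Field F] : Subgroup (GL (Fin 2) F) where
  carrier := {g | ∃ (a : Fˣ) (b : F), (g : Matrix (Fin 2) (Fin 2) F) = !![(a : F), b; 0, 1]}
  one_mem' := ⟨1, 0, by simp [Matrix.one_fin_two]⟩
  mul_mem' := by
    rintro g h ⟨a, b, hg⟩ ⟨c, d, hh⟩
    refine ⟨a * c, a * d + b, ?_⟩
    rw [Units.val_mul, hg, hh, Matrix.mul_fin_two]
    simp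
  inv_mem' := by
    rintro g ⟨a, b, hg⟩
    refine ⟨a⁻¹, -((a⁻¹ : Fˣ) : F) * b, ?_⟩
    refine Units.inv_eq_of_mul_eq_one_right ?_
    rw [hg, Matrix.mul_fin_two, Matrix.one_fin_two]
    simp

/-- The `a²x + b` group over `F`: the matrices `(a² b; 0 1)` with `a ≠ 0`, as a subgroup of the
affine group. -/
def squareAffineGroup (F : Type*) [Field F] : Subgroup (affineGroup F) where
  carrier := {g | ∃ (a : Fˣ) (b : F),
    ((g : GL (Fin 2) F) : Matrix (Fin 2) (Fin 2) F) = !![(a : F) ^ 2, b; 0, 1]}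
  one_mem' := ⟨1, 0, by simp [Matrix.one_fin_two]⟩
  mul_mem' := by
    rintro g h ⟨a, b, hg⟩ ⟨c, d, hh⟩
    refine ⟨a * c, (a : F) ^ 2 * d + b, ?_⟩
    rw [Subgroup.coe_mul, Units.val_mul, hg, hh, Matrix.mul_fin_two]
    simp [mul_pow]
  inv_mem' := by
    rintro g ⟨a, b, hg⟩
    refine ⟨a⁻¹, -((a⁻¹ : Fˣ) : F) ^ 2 * b, ?_⟩
    rw [Subgroup.coe_inv]
    refine Units.inv_eq_of_mul_eq_one_right ?_
    rw [hg, Matrix.mul_fin_two, Matrix.one_fin_two]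
    simp [← mul_assoc]

/-!
Averaging `∑ g, g ⊗ g⁻¹` over conjugacy classes in both factors gives a tensor `D` over the centre
of the group algebra with `a · D = D · a`; multiplication sends it to `|G|⁻¹` times the sum of all
commutators `⁅x, y⁆`. Inverting that central element turns `D` into the diagonal element, whose
projective norm is the `ℓ¹`-norm of its coefficient array, because the centre is isometrically
complemented in `ℓ¹(G)`.

By Frobenius, the commutator sum acts on an irreducible representation of degree `d` as the scalar
`(|G| / d) ^ 2`. If it is the combination of `1` and the idempotent of the commutator subgroup that
corresponds to the degrees `1` and `m`, then its inverse is explicit, which reduces the constant to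
the sizes of the conjugacy classes, and comparing traces shows that every nonlinear irreducible
representation has degree `m`. For the maps `x ↦ s x + b` with `s` in a subgroup `S` of `Fˣ` this
identity, with `m = |S|`, is a direct count of commutators, so no character has to be constructed.
-/

open scoped commutatorElement

/-! ### Projective tensor norms and diagonal elements -/

section ProjectiveNorm

variable {V : Type*} [AddCommGroup V] [Module ℂ V] {N : V → ℝ}

theorem projectiveTensorNorm_le {ι : Type*} [Fintype ι] (hN : ∀ x, 0 ≤ N x) {M : V ⊗[ℂ] V}
    (a b : ι → V) (hM : M = ∑ i, a i ⊗ₜ b i) :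
    projectiveTensorNorm N M ≤ ∑ i, N (a i) * N (b i) := by
  refine csInf_le ⟨0, ?_⟩ ⟨Fintype.card ι, a ∘ (Fintype.equivFin ι).symm,
    b ∘ (Fintype.equivFin ι).symm, ?_, ?_⟩
  · rintro _ ⟨n, a', b', -, rfl⟩
    exact Finset.sum_nonneg fun i _ => mul_nonneg (hN _) (hN _)
  · exact hM.trans ((Fintype.equivFin ι).symm.sum_comp fun i => a i ⊗ₜ[ℂ] b i).symm
  · exact ((Fintype.equivFin ι).symm.sum_comp fun i => N (a i) * N (b i)).symm

theorem le_projectiveTensorNorm {M : V ⊗[ℂ] V} {r : ℝ}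
    (h : ∀ (n : ℕ) (a b : Fin n → V), M = ∑ i, a i ⊗ₜ b i → r ≤ ∑ i, N (a i) * N (b i)) :
    r ≤ projectiveTensorNorm N M := by
  obtain ⟨n, a₀, b₀, hM₀⟩ := TensorProduct.exists_sum_tmul_eq M
  refine le_csInf ⟨_, n, a₀, b₀, hM₀, rfl⟩ ?_
  rintro _ ⟨n, a, b, hM, rfl⟩
  exact h n a b hM

variable {ι : Type*} [Fintype ι] {φ : ι → Module.Dual ℂ V} {v : ι → V}

theorem tensor_eq_sum_dualDistrib_smul (hv : ∀ x, x = ∑ i, φ i x • v i) (M : V ⊗[ℂ] V) :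
    M = ∑ p : ι × ι,
      TensorProduct.dualDistrib ℂ V V (φ p.1 ⊗ₜ φ p.2) M • (v p.1 ⊗ₜ[ℂ] v p.2) := by
  induction M with
  | zero => simp
  | add x y hx hy =>
    simp only [map_add, add_smul, Finset.sum_add_distrib]
    rw [← hx, ← hy]
  | tmul a b =>
    conv_lhs => rw [hv a, hv b]
    simp only [TensorProduct.sum_tmul, TensorProduct.tmul_sum, Fintype.sum_prod_type,
      TensorProduct.dualDistrib_apply, TensorProduct.smul_tmul_smul]
    exact Finset.sum_comm

theorem projectiveTensorNorm_eq_sum_norm (hv : ∀ x, x = ∑ i, φ i x • v i)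
    (hN : ∀ x, N x = ∑ i, ‖φ i x‖) (hNv : ∀ i, N (v i) ≤ 1) (M : V ⊗[ℂ] V) :
    projectiveTensorNorm N M
      = ∑ p : ι × ι, ‖TensorProduct.dualDistrib ℂ V V (φ p.1 ⊗ₜ φ p.2) M‖ := by
  have nonneg (x : V) : 0 ≤ N x := hN x ▸ Finset.sum_nonneg fun _ _ => norm_nonneg _
  apply le_antisymm
  · have hsmul (c : ℂ) (x : V) : N (c • x) = ‖c‖ * N x := by
      simp only [hN, map_smul, smul_eq_mul, norm_mul, Finset.mul_sum]
    refine (projectiveTensorNorm_le nonneg _ _ ((tensor_eq_sum_dualDistrib_smul hv M).trans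
      (Finset.sum_congr rfl fun p _ => TensorProduct.smul_tmul' _ _ _))).trans ?_
    refine Finset.sum_le_sum fun p _ => ?_
    rw [hsmul, mul_assoc]
    exact mul_le_of_le_one_right (norm_nonneg _) (mul_le_one₀ (hNv _) (nonneg _) (hNv _))
  · refine le_projectiveTensorNorm ?_
    rintro n a b rfl
    calc ∑ p : ι × ι, ‖TensorProduct.dualDistrib ℂ V V (φ p.1 ⊗ₜ φ p.2) (∑ i, a i ⊗ₜ b i)‖
        ≤ ∑ p : ι × ι, ∑ i, ‖φ p.1 (a i)‖ * ‖φ p.2 (b i)‖ := by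
          refine Finset.sum_le_sum fun p _ => ?_
          simp only [map_sum, TensorProduct.dualDistrib_apply, ← norm_mul]
          exact norm_sum_le _ _
      _ = ∑ i, N (a i) * N (b i) := by
          rw [Finset.sum_comm]
          simp only [hN, Finset.sum_mul_sum, Fintype.sum_prod_type]

end ProjectiveNorm

section DiagonalElement

variable {A : Type*} [CommRing A] [Algebra ℂ A]

theorem isDiagonalElement_tmul_one_mul {D : A ⊗[ℂ] A} {z : A}
    (hD : ∀ a : A, (a ⊗ₜ[ℂ] (1 : A)) * D = D * ((1 : A) ⊗ₜ[ℂ] a))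
    (hz : z * LinearMap.mul' ℂ A D = 1) :
    IsDiagonalElement A ((z ⊗ₜ[ℂ] (1 : A)) * D) := by
  refine ⟨fun a => by rw [mul_left_comm, hD a, mul_assoc], ?_⟩
  change Algebra.TensorProduct.lmul' ℂ _ = 1
  rw [map_mul, Algebra.TensorProduct.lmul'_apply_tmul, mul_one]
  exact hz

theorem IsDiagonalElement.amenabilityConstant_eq {A : Type*} [Ring A] [Algebra ℂ A]
    [IsMulCommutative A] {M : A ⊗[ℂ] A} (hM : IsDiagonalElement A M) (N : A → ℝ) :
    amenabilityConstant A N = projectiveTensorNorm N M := by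
  let _ : CommRing A := { ‹Ring A› with mul_comm := mul_comm' }
  have hset : {r : ℝ | ∃ M' : A ⊗[ℂ] A, IsDiagonalElement A M' ∧ r = projectiveTensorNorm N M'}
      = {projectiveTensorNorm N M} :=
    Set.Subset.antisymm (fun r ⟨_, hM', hr⟩ => hr.trans (by rw [hM'.unique hM]))
      (Set.singleton_subset_iff.2 ⟨M, hM, rfl⟩)
  rw [amenabilityConstant, hset, csInf_singleton]

end DiagonalElement

/-! ### Central averages and the diagonal element -/

section UniformWeight

variable {α β : Type*} {A B : Set α}

/-- The uniform probability vector on a finite set `A`. It vanishes identically when `A` is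
infinite, since then `A.ncard = 0`. -/
noncomputable def uniformWeight (A : Set α) : α → ℝ :=
  A.indicator fun _ => (A.ncard : ℝ)⁻¹

theorem uniformWeight_preimage_equiv (e : α ≃ β) (B : Set β) (x : α) :
    uniformWeight (e ⁻¹' B) x = uniformWeight B (e x) := by
  rw [uniformWeight, uniformWeight, Set.ncard_preimage_of_injective_subset_range e.injective
    (by simp [e.surjective.range_eq])]
  rfl

variable [Fintype α]

theorem sum_uniformWeight (hA : A.Nonempty) : ∑ x, uniformWeight A x = 1 := by
  classical
  have hcard : (A.ncard : ℝ) ≠ 0 := Nat.cast_ne_zero.2 ((Set.ncard_pos A.toFinite).2 hA).ne'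
  simp [uniformWeight, Set.indicator_apply, Finset.sum_ite, ← Set.ncard_coe_finset, hcard]

theorem sum_abs_sub_uniformWeight {t : ℝ} (ht : 1 ≤ t) (hA : A.Nonempty) (hAB : A ⊆ B) :
    ∑ x, |t * uniformWeight A x - (t - 1) * uniformWeight B x|
      = 2 * t - 1 - 2 * (t - 1) * (A.ncard / B.ncard) := by
  have hApos : (0 : ℝ) < A.ncard := Nat.cast_pos.2 ((Set.ncard_pos A.toFinite).2 hA)
  have hcard : (A.ncard : ℝ) ≤ B.ncard := Nat.cast_le.2 (Set.ncard_le_ncard hAB B.toFinite)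
  have pointwise (x : α) : |t * uniformWeight A x - (t - 1) * uniformWeight B x|
      = t * uniformWeight A x + (t - 1) * uniformWeight B x
        - 2 * (t - 1) * (A.ncard / B.ncard) * uniformWeight A x := by
    by_cases hxA : x ∈ A
    · have hinv : (B.ncard : ℝ)⁻¹ ≤ (A.ncard : ℝ)⁻¹ := inv_anti₀ hApos hcard
      have hB0 : 0 ≤ (B.ncard : ℝ)⁻¹ := by positivity
      simp only [uniformWeight, Set.indicator_of_mem hxA, Set.indicator_of_mem (hAB hxA)]
      rw [abs_of_nonneg (by nlinarith)]
      field_simp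
      ring
    · have hB0 : 0 ≤ uniformWeight B x := Set.indicator_nonneg (fun _ _ => by positivity) x
      have hA0 : uniformWeight A x = 0 := Set.indicator_of_notMem hxA _
      rw [hA0, mul_zero, mul_zero, zero_sub, abs_neg, zero_add, sub_zero,
        abs_of_nonneg (mul_nonneg (by linarith) hB0)]
  simp only [pointwise, Finset.sum_sub_distrib, Finset.sum_add_distrib, ← Finset.mul_sum,
    sum_uniformWeight hA, sum_uniformWeight (hA.mono hAB)]
  ring

end UniformWeight

/-- The centre `Zℓ¹(G)` of the complex group algebra. -/
abbrev GroupAlgebraCenter (G : Type*) [Group G] : Type _ :=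
  Subalgebra.center ℂ (MonoidAlgebra ℂ G)

section CentralAverage

variable {G : Type*} [Group G]

theorem mem_center_monoidAlgebra_iff {f : MonoidAlgebra ℂ G} :
    f ∈ Subalgebra.center ℂ (MonoidAlgebra ℂ G) ↔
      ∀ x : G, MonoidAlgebra.single x 1 * f = f * MonoidAlgebra.single x 1 := by
  rw [Subalgebra.mem_center_iff]
  refine ⟨fun h x => h _, fun h a => ?_⟩
  induction a using MonoidAlgebra.induction_linear with
  | zero => rw [zero_mul, mul_zero]
  | add a b ha hb => rw [add_mul, mul_add, ha, hb]
  | single x r =>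
    have hx : MonoidAlgebra.single x r = r • (MonoidAlgebra.single x 1 : MonoidAlgebra ℂ G) := by
      simp
    rw [hx, smul_mul_assoc, h x, mul_smul_comm]

theorem conj_mul_of_mem_center {z : MonoidAlgebra ℂ G}
    (hz : z ∈ Subalgebra.center ℂ (MonoidAlgebra ℂ G)) (f : MonoidAlgebra ℂ G) (x : G) :
    MonoidAlgebra.single x 1 * (z * f) * MonoidAlgebra.single x⁻¹ 1
      = z * (MonoidAlgebra.single x 1 * f * MonoidAlgebra.single x⁻¹ 1) := by
  rw [← mul_assoc, mem_center_monoidAlgebra_iff.1 hz x, mul_assoc, mul_assoc, mul_assoc]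

theorem coeff_conj_of_mem_center {z : MonoidAlgebra ℂ G}
    (hz : z ∈ Subalgebra.center ℂ (MonoidAlgebra ℂ G)) (g x : G) :
    z.coeff (x * g * x⁻¹) = z.coeff g := by
  have h := congrArg (fun f => f.coeff (x * g)) (mem_center_monoidAlgebra_iff.1 hz x)
  simpa [MonoidAlgebra.coeff_single_mul_apply, MonoidAlgebra.coeff_mul_single_apply] using h.symm

/-- The functional reading off the coefficient of a central element at `g`. -/
noncomputable def centerCoeff (g : G) : Module.Dual ℂ (GroupAlgebraCenter G) where
  toFun z := (z : MonoidAlgebra ℂ G).coeff g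
  map_add' _ _ := rfl
  map_smul' _ _ := rfl

theorem centerCoeff_apply (g : G) (z : GroupAlgebraCenter G) :
    centerCoeff g z = (z : MonoidAlgebra ℂ G).coeff g :=
  rfl

variable [Fintype G]

/-- The projection `f ↦ |G|⁻¹ ∑ x, x f x⁻¹` of the group algebra onto its centre. -/
noncomputable def centralAverage (G : Type*) [Group G] [Fintype G] :
    MonoidAlgebra ℂ G →ₗ[ℂ] GroupAlgebraCenter G where
  toFun f := ⟨(Fintype.card G : ℂ)⁻¹ •
      ∑ x : G, MonoidAlgebra.single x 1 * f * MonoidAlgebra.single x⁻¹ 1, by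
    refine Subalgebra.smul_mem _ (mem_center_monoidAlgebra_iff.2 fun y => ?_) _
    rw [Finset.mul_sum, Finset.sum_mul]
    refine Fintype.sum_equiv (Equiv.mulLeft y) _ _ fun x => ?_
    simp only [Equiv.coe_mulLeft, mul_inv_rev, mul_assoc, MonoidAlgebra.single_mul_single,
      inv_mul_cancel, mul_one]
    simp only [← mul_assoc, MonoidAlgebra.single_mul_single, mul_one]⟩
  map_add' f f' := Subtype.ext <| by
    simp only [mul_add, add_mul, Finset.sum_add_distrib, smul_add, Subalgebra.coe_add]
  map_smul' c f := Subtype.ext <| by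
    simp only [mul_smul_comm, smul_mul_assoc, ← Finset.smul_sum, RingHom.id_apply,
      Subalgebra.coe_smul]
    rw [smul_comm]

theorem coe_centralAverage (f : MonoidAlgebra ℂ G) :
    (centralAverage G f : MonoidAlgebra ℂ G) = (Fintype.card G : ℂ)⁻¹ •
      ∑ x : G, MonoidAlgebra.single x 1 * f * MonoidAlgebra.single x⁻¹ 1 :=
  rfl

theorem centralAverage_coe (z : GroupAlgebraCenter G) :
    centralAverage G (z : MonoidAlgebra ℂ G) = z := by
  have hconj (x : G) : MonoidAlgebra.single x (1 : ℂ) * (z : MonoidAlgebra ℂ G)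
      * MonoidAlgebra.single x⁻¹ 1 = (z : MonoidAlgebra ℂ G) := by
    rw [mem_center_monoidAlgebra_iff.1 z.2, mul_assoc, MonoidAlgebra.single_mul_single,
      mul_inv_cancel, mul_one, ← MonoidAlgebra.one_def, mul_one]
  refine Subtype.ext ?_
  rw [coe_centralAverage, Finset.sum_congr rfl fun x _ => hconj x, Finset.sum_const,
    Finset.card_univ, ← Nat.cast_smul_eq_nsmul ℂ,
    inv_smul_smul₀ (Nat.cast_ne_zero.2 Fintype.card_ne_zero)]

theorem centralAverage_mul (z : GroupAlgebraCenter G) (f : MonoidAlgebra ℂ G) :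
    centralAverage G ((z : MonoidAlgebra ℂ G) * f) = z * centralAverage G f := by
  refine Subtype.ext ?_
  simp only [Subalgebra.coe_mul, coe_centralAverage, conj_mul_of_mem_center z.2, mul_smul_comm,
    Finset.mul_sum]

/-- The average of the conjugates of `g`, as an element of the centre of the group algebra. -/
noncomputable def classAverage (g : G) : GroupAlgebraCenter G :=
  centralAverage G (MonoidAlgebra.single g 1)

theorem coe_classAverage (g : G) :
    (classAverage g : MonoidAlgebra ℂ G)
      = (Fintype.card G : ℂ)⁻¹ • ∑ x : G, MonoidAlgebra.single (x * g * x⁻¹) 1 := by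
  simp only [classAverage, coe_centralAverage, MonoidAlgebra.single_mul_single, mul_one]

theorem center_eq_sum_centerCoeff_smul (z : GroupAlgebraCenter G) :
    z = ∑ g, centerCoeff g z • classAverage g := by
  have hz : (z : MonoidAlgebra ℂ G)
      = ∑ g, (z : MonoidAlgebra ℂ G).coeff g • MonoidAlgebra.single g 1 := by
    simp only [MonoidAlgebra.smul_single, smul_eq_mul, mul_one]
    exact (MonoidAlgebra.sum_coeff_single z.1).symm.trans (Finsupp.sum_fintype _ _ (by simp))
  conv_lhs => rw [← centralAverage_coe z, hz, map_sum]
  simp only [map_smul, classAverage, centerCoeff_apply]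

theorem coeff_classAverage_eq_sum [DecidableEq G] (g h : G) :
    (classAverage g : MonoidAlgebra ℂ G).coeff h
      = (Fintype.card G : ℂ)⁻¹ * ∑ x : G, if x * g * x⁻¹ = h then 1 else 0 := by
  simp [coe_classAverage, MonoidAlgebra.coeff_sum, MonoidAlgebra.coeff_single,
    Finsupp.single_apply]

theorem coeff_classAverage_inv_comm (g h : G) :
    (classAverage g⁻¹ : MonoidAlgebra ℂ G).coeff h
      = (classAverage h⁻¹ : MonoidAlgebra ℂ G).coeff g := by
  classical
  rw [coeff_classAverage_eq_sum, coeff_classAverage_eq_sum]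
  congr 1
  refine Fintype.sum_equiv (Equiv.inv G) _ _ fun x => if_congr ?_ rfl rfl
  rw [Equiv.inv_apply, inv_inv, ← inv_inj, mul_inv_rev, mul_inv_rev, inv_inv, inv_inv,
    mul_assoc, ← eq_inv_mul_iff_mul_eq, mul_inv_eq_iff_eq_mul, eq_comm, mul_assoc]

theorem coeff_classAverage (g h : G) :
    (classAverage g : MonoidAlgebra ℂ G).coeff h = uniformWeight (conjugatesOf g) h := by
  classical
  have hcard : (Fintype.card G : ℂ) ≠ 0 := Nat.cast_ne_zero.2 Fintype.card_ne_zero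
  have hout {h : G} (hh : h ∉ conjugatesOf g) :
      (classAverage g : MonoidAlgebra ℂ G).coeff h = 0 := by
    rw [coeff_classAverage_eq_sum, Finset.sum_eq_zero, mul_zero]
    exact fun x _ => if_neg fun hx => hh (isConj_iff.2 ⟨x, hx⟩)
  have hin {h : G} (hh : h ∈ conjugatesOf g) : (classAverage g : MonoidAlgebra ℂ G).coeff h
      = (classAverage g : MonoidAlgebra ℂ G).coeff g := by
    obtain ⟨x, rfl⟩ := isConj_iff.1 hh
    exact coeff_conj_of_mem_center (classAverage g).2 g x
  have hsum : ((conjugatesOf g).ncard : ℂ) * (classAverage g : MonoidAlgebra ℂ G).coeff g = 1 := by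
    calc ((conjugatesOf g).ncard : ℂ) * (classAverage g : MonoidAlgebra ℂ G).coeff g
        = ∑ h, (classAverage g : MonoidAlgebra ℂ G).coeff h := by
          rw [Set.ncard_eq_toFinset_card', ← nsmul_eq_mul, ← Finset.sum_const]
          refine Finset.sum_subset_zero_on_sdiff (Finset.subset_univ _) (fun h hh => hout ?_)
            fun h hh => (hin (Set.mem_toFinset.1 hh)).symm
          simpa using hh
      _ = 1 := by
          simp only [coeff_classAverage_eq_sum, ← Finset.mul_sum]
          rw [Finset.sum_comm]
          simp [hcard]
  by_cases hh : h ∈ conjugatesOf g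
  · rw [hin hh, uniformWeight, Set.indicator_of_mem hh, Complex.ofReal_inv,
      Complex.ofReal_natCast, eq_inv_of_mul_eq_one_right hsum]
  · rw [hout hh, uniformWeight, Set.indicator_of_notMem hh, Complex.ofReal_zero]

end CentralAverage

section Diagonal

variable {G : Type*} [Group G] [Fintype G]

theorem l1Norm_eq_sum_norm_coeff (f : MonoidAlgebra ℂ G) : l1Norm f = ∑ g, ‖f.coeff g‖ :=
  Finsupp.sum_fintype _ _ fun _ => norm_zero

theorem l1Norm_classAverage (g : G) : l1Norm (classAverage g : MonoidAlgebra ℂ G) = 1 := by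
  rw [l1Norm_eq_sum_norm_coeff, ← sum_uniformWeight ⟨g, mem_conjugatesOf_self⟩]
  refine Finset.sum_congr rfl fun h _ => ?_
  rw [coeff_classAverage, Complex.norm_real, Real.norm_of_nonneg]
  exact Set.indicator_nonneg (fun _ _ => by positivity) h

theorem projectiveTensorNorm_center (M : GroupAlgebraCenter G ⊗[ℂ] GroupAlgebraCenter G) :
    projectiveTensorNorm (fun z : GroupAlgebraCenter G => l1Norm z.1) M
      = ∑ p : G × G,
          ‖TensorProduct.dualDistrib ℂ _ _ (centerCoeff p.1 ⊗ₜ centerCoeff p.2) M‖ := by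
  have hnorm (z : GroupAlgebraCenter G) : l1Norm z.1 = ∑ g, ‖centerCoeff g z‖ := by
    simp only [l1Norm_eq_sum_norm_coeff, centerCoeff_apply]
  have hclass (g : G) : l1Norm (classAverage g).1 ≤ 1 := (l1Norm_classAverage g).le
  exact projectiveTensorNorm_eq_sum_norm (N := fun z : GroupAlgebraCenter G => l1Norm z.1)
    center_eq_sum_centerCoeff_smul hnorm hclass M

theorem zlAmenabilityConstant_eq_sum_norm
    {M : GroupAlgebraCenter G ⊗[ℂ] GroupAlgebraCenter G} (hM : IsDiagonalElement _ M) :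
    zlAmenabilityConstant G = ∑ p : G × G,
      ‖TensorProduct.dualDistrib ℂ _ _ (centerCoeff p.1 ⊗ₜ centerCoeff p.2) M‖ :=
  (hM.amenabilityConstant_eq _).trans (projectiveTensorNorm_center M)

/-- The tensor `∑ g, g ⊗ g⁻¹` averaged over conjugacy classes in both factors. It intertwines the
two module structures, so it is a diagonal element up to a factor from the centre. -/
noncomputable def classTensor (G : Type*) [Group G] [Fintype G] :
    GroupAlgebraCenter G ⊗[ℂ] GroupAlgebraCenter G :=
  ∑ g : G, classAverage g ⊗ₜ classAverage g⁻¹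

theorem sum_centralAverage_mul_tmul (f : MonoidAlgebra ℂ G) :
    ∑ g : G, centralAverage G (f * MonoidAlgebra.single g 1) ⊗ₜ[ℂ] classAverage g⁻¹
      = ∑ g : G, classAverage g ⊗ₜ[ℂ] centralAverage G (MonoidAlgebra.single g⁻¹ 1 * f) := by
  induction f using MonoidAlgebra.induction_linear with
  | zero => simp
  | add f f' hf hf' =>
    simp only [add_mul, mul_add, map_add, TensorProduct.add_tmul, TensorProduct.tmul_add,
      Finset.sum_add_distrib, hf, hf']
  | single x r =>
    refine Fintype.sum_equiv (Equiv.mulLeft x) _ _ fun g => ?_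
    have hr (y : G) :
        centralAverage G (MonoidAlgebra.single y r) = r • classAverage y := by
      rw [classAverage, ← map_smul, MonoidAlgebra.smul_single, smul_eq_mul, mul_one]
    simp only [MonoidAlgebra.single_mul_single, Equiv.coe_mulLeft, mul_inv_rev,
      inv_mul_cancel_right, mul_one, one_mul, hr, TensorProduct.smul_tmul]

theorem tmul_one_mul_classTensor (z : GroupAlgebraCenter G) :
    (z ⊗ₜ[ℂ] (1 : GroupAlgebraCenter G)) * classTensor G
      = ∑ g : G, (z * classAverage g) ⊗ₜ classAverage g⁻¹ := by
  simp only [classTensor, Finset.mul_sum, Algebra.TensorProduct.tmul_mul_tmul, one_mul]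

theorem tmul_one_mul_classTensor_comm (z : GroupAlgebraCenter G) :
    (z ⊗ₜ[ℂ] (1 : GroupAlgebraCenter G)) * classTensor G
      = classTensor G * ((1 : GroupAlgebraCenter G) ⊗ₜ[ℂ] z) := by
  rw [mul_comm (classTensor G)]
  simp only [classTensor, Finset.mul_sum, Algebra.TensorProduct.tmul_mul_tmul, one_mul]
  simpa only [classAverage, mem_center_monoidAlgebra_iff.1 z.2, centralAverage_mul]
    using sum_centralAverage_mul_tmul (z : MonoidAlgebra ℂ G)

theorem dualDistrib_tmul_one_mul_classTensor (z : GroupAlgebraCenter G) (g h : G) :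
    TensorProduct.dualDistrib ℂ _ _ (centerCoeff g ⊗ₜ centerCoeff h)
        ((z ⊗ₜ[ℂ] (1 : GroupAlgebraCenter G)) * classTensor G)
      = centerCoeff g (z * classAverage h⁻¹) := by
  calc TensorProduct.dualDistrib ℂ _ _ (centerCoeff g ⊗ₜ centerCoeff h)
        ((z ⊗ₜ[ℂ] (1 : GroupAlgebraCenter G)) * classTensor G)
      = ∑ k : G, (classAverage h⁻¹ : MonoidAlgebra ℂ G).coeff k
          * centerCoeff g (z * classAverage k) := by
        simp only [tmul_one_mul_classTensor, map_sum, TensorProduct.dualDistrib_apply,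
          centerCoeff_apply h, coeff_classAverage_inv_comm _ h, mul_comm (centerCoeff g _)]
    _ = centerCoeff g (z * classAverage h⁻¹) := by
        simp only [← centerCoeff_apply]
        conv_rhs => rw [center_eq_sum_centerCoeff_smul (classAverage h⁻¹)]
        simp only [Finset.mul_sum, mul_smul_comm, map_sum, map_smul, smul_eq_mul]

/-- The sum of all commutators, as an element of the group algebra. By Frobenius, it acts on an
irreducible representation of degree `d` as the scalar `(|G| / d) ^ 2`. -/
noncomputable def commutatorSum (G : Type*) [Group G] [Fintype G] : MonoidAlgebra ℂ G :=
  ∑ x : G, ∑ y : G, MonoidAlgebra.single ⁅x, y⁆ 1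

theorem mul'_classTensor :
    LinearMap.mul' ℂ _ (classTensor G)
      = (Fintype.card G : ℂ)⁻¹ • centralAverage G (commutatorSum G) := by
  have hterm (g : G) : classAverage g * classAverage g⁻¹
      = (Fintype.card G : ℂ)⁻¹ • ∑ x : G, centralAverage G (MonoidAlgebra.single ⁅x, g⁆ 1) := by
    rw [classAverage.eq_1 g⁻¹, ← centralAverage_mul, coe_classAverage, smul_mul_assoc, map_smul,
      Finset.sum_mul, map_sum]
    simp only [MonoidAlgebra.single_mul_single, mul_one, commutatorElement_def]
  simp only [classTensor, map_sum, LinearMap.mul'_apply, hterm, commutatorSum, ← Finset.smul_sum]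
  rw [Finset.sum_comm]

end Diagonal

/-! ### The two-degree formula for the commutator sum -/

section SubgroupAverage

variable {G : Type*} [Group G] [Fintype G] {H : Subgroup G}

/-- The idempotent `|H|⁻¹ ∑ h ∈ H, h` of the group algebra attached to a subgroup `H`. -/
noncomputable def subgroupAverage (H : Subgroup G) : MonoidAlgebra ℂ G :=
  ∑ g : G, MonoidAlgebra.single g (uniformWeight (H : Set G) g : ℂ)

theorem coeff_subgroupAverage (H : Subgroup G) (g : G) :
    (subgroupAverage H).coeff g = uniformWeight (H : Set G) g := by
  classical
  simp [subgroupAverage, Finsupp.single_apply]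

theorem uniformWeight_congr_mem {α : Type*} {A : Set α} {x y : α} (h : x ∈ A ↔ y ∈ A) :
    uniformWeight A x = uniformWeight A y := by
  classical
  simp only [uniformWeight, Set.indicator_apply, h]

theorem single_mul_subgroupAverage {h : G} (hh : h ∈ H) :
    MonoidAlgebra.single h 1 * subgroupAverage H = subgroupAverage H := by
  ext g
  rw [MonoidAlgebra.coeff_single_mul_apply, one_mul, coeff_subgroupAverage, coeff_subgroupAverage,
    uniformWeight_congr_mem (H.mul_mem_cancel_left (H.inv_mem hh))]

theorem subgroupAverage_mul_self (H : Subgroup G) :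
    subgroupAverage H * subgroupAverage H = subgroupAverage H := by
  have hterm (g : G) :
      MonoidAlgebra.single g (uniformWeight (H : Set G) g : ℂ) * subgroupAverage H
        = (uniformWeight (H : Set G) g : ℂ) • subgroupAverage H := by
    by_cases hg : g ∈ H
    · have hsmul : MonoidAlgebra.single g (uniformWeight (H : Set G) g : ℂ)
          = (uniformWeight (H : Set G) g : ℂ) • MonoidAlgebra.single g 1 := by
        rw [MonoidAlgebra.smul_single, smul_eq_mul, mul_one]
      rw [hsmul, smul_mul_assoc, single_mul_subgroupAverage hg]
    · simp [uniformWeight, hg]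
  conv_lhs => enter [1]; rw [subgroupAverage]
  rw [Finset.sum_mul, Finset.sum_congr rfl fun g _ => hterm g, ← Finset.sum_smul,
    ← Complex.ofReal_sum, sum_uniformWeight ⟨1, H.one_mem⟩, Complex.ofReal_one, one_smul]

theorem subgroupAverage_mem_center [hH : H.Normal] :
    subgroupAverage H ∈ Subalgebra.center ℂ (MonoidAlgebra ℂ G) := by
  refine mem_center_monoidAlgebra_iff.2 fun x => ?_
  ext g
  rw [MonoidAlgebra.coeff_single_mul_apply, MonoidAlgebra.coeff_mul_single_apply, one_mul, mul_one,
    coeff_subgroupAverage, coeff_subgroupAverage, uniformWeight_congr_mem hH.mem_comm_iff]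

end SubgroupAverage

theorem conjugatesOf_subset_preimage_commutator {G : Type*} [Group G] (h : G) :
    conjugatesOf h ⊆ (Equiv.mulRight h⁻¹) ⁻¹' (commutator G : Set G) := by
  intro k hk
  obtain ⟨x, rfl⟩ := isConj_iff.1 hk
  exact Subgroup.commutator_mem_commutator (Subgroup.mem_top x) (Subgroup.mem_top h)

section TwoDegrees

variable {G : Type*} [Group G] [Fintype G] {m : ℕ}

/-- The commutator sum acts as if every irreducible representation were either linear or of
degree `m`: in view of Frobenius' scalars `(|G| / d) ^ 2`, it is `|G| ^ 2` on the image of the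
idempotent of the commutator subgroup and `(|G| / m) ^ 2` on the complement. -/
def HasTwoDegreeCommutatorSum (G : Type*) [Group G] [Fintype G] (m : ℕ) : Prop :=
  commutatorSum G = (Fintype.card G : ℂ) ^ 2 • (subgroupAverage (commutator G)
    + ((m : ℂ) ^ 2)⁻¹ • (1 - subgroupAverage (commutator G)))

/-- The idempotent of the commutator subgroup, as an element of the centre of the group
algebra. -/
noncomputable def commutatorIdempotent (G : Type*) [Group G] [Fintype G] : GroupAlgebraCenter G :=
  ⟨subgroupAverage (commutator G), subgroupAverage_mem_center⟩

theorem isIdempotentElem_commutatorIdempotent : IsIdempotentElem (commutatorIdempotent G) :=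
  Subtype.ext (subgroupAverage_mul_self _)

theorem centerCoeff_commutatorIdempotent_mul_classAverage (g h : G) :
    centerCoeff g (commutatorIdempotent G * classAverage h)
      = uniformWeight ((Equiv.mulRight h⁻¹) ⁻¹' (commutator G : Set G)) g := by
  have hconj (x : G) : subgroupAverage (commutator G) * MonoidAlgebra.single (x * h * x⁻¹) 1
      = subgroupAverage (commutator G) * MonoidAlgebra.single h 1 := by
    have hx : ⁅x, h⁆ ∈ commutator G :=
      Subgroup.commutator_mem_commutator (Subgroup.mem_top x) (Subgroup.mem_top h)
    have hsplit : x * h * x⁻¹ = ⁅x, h⁆ * h := by rw [commutatorElement_def, inv_mul_cancel_right]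
    rw [hsplit, ← mul_one (1 : ℂ), ← MonoidAlgebra.single_mul_single, ← mul_assoc,
      ← mem_center_monoidAlgebra_iff.1 subgroupAverage_mem_center, single_mul_subgroupAverage hx,
      mul_one]
  have hmul : (commutatorIdempotent G * classAverage h : GroupAlgebraCenter G).1
      = subgroupAverage (commutator G) * MonoidAlgebra.single h 1 := by
    rw [Subalgebra.coe_mul, coe_classAverage, mul_smul_comm, Finset.mul_sum]
    change _ • ∑ x : G, subgroupAverage (commutator G) * _ = _
    rw [Finset.sum_congr rfl fun x _ => hconj x, Finset.sum_const, Finset.card_univ,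
      ← Nat.cast_smul_eq_nsmul ℂ, inv_smul_smul₀ (Nat.cast_ne_zero.2 Fintype.card_ne_zero)]
  rw [centerCoeff_apply, hmul, MonoidAlgebra.coeff_mul_single_apply, mul_one,
    coeff_subgroupAverage, uniformWeight_preimage_equiv, Equiv.coe_mulRight]

theorem idempotent_combination_mul_eq_one {K A : Type*} [Field K] [Ring A] [Algebra K A] {e : A}
    {c : K} (he : IsIdempotentElem e) (hc : c ≠ 0) :
    (c • (1 : A) + (1 - c) • e) * (e + c⁻¹ • (1 - e)) = 1 := by
  simp only [sub_eq_add_neg, mul_add, add_mul, smul_add, smul_mul_assoc, mul_smul_comm, one_mul,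
    mul_one, mul_neg, he.eq]
  match_scalars <;> field_simp
  ring

/-- The inverse of the image of `classTensor G` under multiplication, when all nonlinear degrees
equal `m`. -/
noncomputable def diagonalFactor (G : Type*) [Group G] [Fintype G] (m : ℕ) :
    GroupAlgebraCenter G :=
  (Fintype.card G : ℂ)⁻¹ •
    ((m : ℂ) ^ 2 • (1 : GroupAlgebraCenter G) + (1 - (m : ℂ) ^ 2) • commutatorIdempotent G)

theorem HasTwoDegreeCommutatorSum.diagonalFactor_mul (hG : HasTwoDegreeCommutatorSum G m)
    (hm : m ≠ 0) : diagonalFactor G m * LinearMap.mul' ℂ _ (classTensor G) = 1 := by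
  have hsum : commutatorSum G = ((Fintype.card G : ℂ) ^ 2 • (commutatorIdempotent G
      + ((m : ℂ) ^ 2)⁻¹ • ((1 : GroupAlgebraCenter G) - commutatorIdempotent G)) :
        GroupAlgebraCenter G).1 := hG
  have hcard : (Fintype.card G : ℂ) ≠ 0 := Nat.cast_ne_zero.2 Fintype.card_ne_zero
  have hm2 : (m : ℂ) ^ 2 ≠ 0 := pow_ne_zero 2 (Nat.cast_ne_zero.2 hm)
  have hcancel :
      (Fintype.card G : ℂ)⁻¹ * (Fintype.card G : ℂ)⁻¹ * (Fintype.card G : ℂ) ^ 2 = 1 := by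
    field_simp
  rw [mul'_classTensor, hsum, centralAverage_coe, diagonalFactor, smul_mul_assoc, mul_smul_comm,
    mul_smul_comm, smul_smul, smul_smul, hcancel, one_smul]
  exact idempotent_combination_mul_eq_one isIdempotentElem_commutatorIdempotent hm2

theorem HasTwoDegreeCommutatorSum.isDiagonalElement (hG : HasTwoDegreeCommutatorSum G m)
    (hm : m ≠ 0) : IsDiagonalElement (GroupAlgebraCenter G)
      ((diagonalFactor G m ⊗ₜ[ℂ] (1 : GroupAlgebraCenter G)) * classTensor G) :=
  isDiagonalElement_tmul_one_mul tmul_one_mul_classTensor_comm (hG.diagonalFactor_mul hm)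

theorem centerCoeff_diagonalFactor_mul_classAverage (g h : G) :
    centerCoeff g (diagonalFactor G m * classAverage h)
      = (((Fintype.card G : ℝ)⁻¹ * ((m : ℝ) ^ 2 * uniformWeight (conjugatesOf h) g
          - ((m : ℝ) ^ 2 - 1)
            * uniformWeight ((Equiv.mulRight h⁻¹) ⁻¹' (commutator G : Set G)) g) : ℝ) : ℂ) := by
  simp only [diagonalFactor, smul_mul_assoc, add_mul, one_mul, map_smul, map_add, smul_eq_mul,
    centerCoeff_commutatorIdempotent_mul_classAverage, centerCoeff_apply g (classAverage h),
    coeff_classAverage]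
  push_cast
  ring

theorem sum_norm_centerCoeff_diagonalFactor_mul_classAverage (hm : m ≠ 0) (h : G) :
    ∑ g, ‖centerCoeff g (diagonalFactor G m * classAverage h)‖
      = (Fintype.card G : ℝ)⁻¹ * (2 * (m : ℝ) ^ 2 - 1
          - 2 * ((m : ℝ) ^ 2 - 1) * ((conjugatesOf h).ncard / Nat.card (commutator G))) := by
  have hm1 : (1 : ℝ) ≤ (m : ℝ) ^ 2 := one_le_pow₀ (Nat.one_le_cast.2 (Nat.one_le_iff_ne_zero.2 hm))
  have hncard : ((Equiv.mulRight h⁻¹) ⁻¹' (commutator G : Set G)).ncard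
      = Nat.card (commutator G) :=
    Set.ncard_preimage_of_injective_subset_range (Equiv.injective _)
      ((Set.subset_univ _).trans_eq (Equiv.surjective _).range_eq.symm)
  have habs : |(Fintype.card G : ℝ)⁻¹| = (Fintype.card G : ℝ)⁻¹ := abs_of_nonneg (by positivity)
  simp only [centerCoeff_diagonalFactor_mul_classAverage, Complex.norm_real, abs_mul,
    Real.norm_eq_abs, ← Finset.mul_sum, habs]
  rw [sum_abs_sub_uniformWeight hm1 ⟨h, mem_conjugatesOf_self⟩
    (conjugatesOf_subset_preimage_commutator h), hncard]

theorem HasTwoDegreeCommutatorSum.zlAmenabilityConstant_eq (hG : HasTwoDegreeCommutatorSum G m)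
    (hm : m ≠ 0) :
    zlAmenabilityConstant G
      = 1 + 2 * ((m : ℝ) ^ 2 - 1) * (1 - (∑ g : G, (conjugatesOf g).ncard : ℕ)
          / (Nat.card G * Nat.card (commutator G))) := by
  have hcard : (Fintype.card G : ℝ) ≠ 0 := Nat.cast_ne_zero.2 Fintype.card_ne_zero
  rw [zlAmenabilityConstant_eq_sum_norm (hG.isDiagonalElement hm), Fintype.sum_prod_type_right,
    ← Equiv.sum_comp (Equiv.inv G)]
  simp only [dualDistrib_tmul_one_mul_classTensor, Equiv.inv_apply, inv_inv,
    sum_norm_centerCoeff_diagonalFactor_mul_classAverage hm]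
  rw [← Finset.mul_sum, Finset.sum_sub_distrib, ← Finset.mul_sum, ← Finset.sum_div,
    Finset.sum_const, Finset.card_univ, nsmul_eq_mul, Nat.card_eq_fintype_card (α := G),
    Nat.cast_sum]
  field_simp
  ring

end TwoDegrees

/-! ### Character degrees -/

section Schur

variable {k G V : Type*} [Field k] [Monoid G] [AddCommGroup V] [Module k V]
  {ρ : Representation k G V}

theorem nontrivial_of_isIrreducible (hρ : ρ.IsIrreducible) : Nontrivial V := by
  by_contra hV
  rw [not_nontrivial_iff_subsingleton] at hV
  exact bot_ne_top (α := Subrepresentation ρ)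
    (Subrepresentation.toSubmodule_injective (Subsingleton.elim _ _))

theorem exists_eq_smul_one_of_commute [IsAlgClosed k] [FiniteDimensional k V]
    (hρ : ρ.IsIrreducible) {T : Module.End k V} (hT : ∀ g, Commute T (ρ g)) :
    ∃ c : k, T = c • (1 : Module.End k V) := by
  obtain ⟨c, hc⟩ :=
    Representation.IsIrreducible.algebraMap_intertwiningMap_bijective_of_isAlgClosed.2
      (⟨T, fun g => (hT g).eq⟩ : ρ.IntertwiningMap ρ)
  exact ⟨c, (congrArg Representation.IntertwiningMap.toLinearMap hc).symm⟩

theorem finrank_eq_one_of_commute [IsAlgClosed k] [FiniteDimensional k V]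
    (hρ : ρ.IsIrreducible) (hcomm : ∀ g h, Commute (ρ g) (ρ h)) : Module.finrank k V = 1 := by
  have := nontrivial_of_isIrreducible hρ
  refine isSimpleModule_iff_finrank_eq_one.1 ((isSimpleModule_iff k V).2 ⟨fun W => ?_⟩)
  have hW (g : G) (v : V) (hv : v ∈ W) : ρ g v ∈ W := by
    obtain ⟨c, hc⟩ := exists_eq_smul_one_of_commute hρ (hcomm g)
    simpa [hc] using W.smul_mem c hv
  exact (eq_bot_or_eq_top (⟨W, hW⟩ : Subrepresentation ρ)).imp
    (congrArg Subrepresentation.toSubmodule) (congrArg Subrepresentation.toSubmodule)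

end Schur

theorem trace_eq_det_of_finrank_eq_one {k V : Type*} [Field k] [AddCommGroup V] [Module k V]
    (hV : Module.finrank k V = 1) (T : Module.End k V) :
    LinearMap.trace k V T = LinearMap.det T := by
  obtain ⟨c, rfl⟩ := (T.existsUnique_eq_smul_id_of_finrank_eq_one hV).exists
  have := Module.finite_of_finrank_eq_succ hV
  rw [map_smul, LinearMap.trace_id, hV, LinearMap.det_smul, LinearMap.det_id, hV]
  simp

theorem isLinearCharacter_of_finrank_eq_one {G V : Type*} [Group G] [Finite G] [AddCommGroup V]
    [Module ℂ V] {ρ : Representation ℂ G V} (hV : Module.finrank ℂ V = 1) :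
    IsLinearCharacter ρ.character := by
  let φ : G →* ℂ := LinearMap.det.comp ρ
  have hnorm (g : G) : φ g ∈ Submonoid.unitSphere ℂ :=
    mem_sphere_zero_iff_norm.2 (Complex.norm_eq_one_of_pow_eq_one
      (by rw [← map_pow, pow_card_eq_one', map_one]) Nat.card_pos.ne')
  exact ⟨φ.codRestrict (Submonoid.unitSphere ℂ) hnorm,
    fun g => trace_eq_det_of_finrank_eq_one hV (ρ g)⟩

section Degrees

variable {G V : Type*} [Group G] [Fintype G] [AddCommGroup V] [Module ℂ V]
  [FiniteDimensional ℂ V] {ρ : Representation ℂ G V} {m : ℕ}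

theorem sum_conj_eq_smul_one (hρ : ρ.IsIrreducible) (y : G) :
    ∑ x, ρ (x * y * x⁻¹)
      = (Fintype.card G * ρ.character y / Module.finrank ℂ V) • (1 : Module.End ℂ V) := by
  have := nontrivial_of_isIrreducible hρ
  have hn : (Module.finrank ℂ V : ℂ) ≠ 0 := Nat.cast_ne_zero.2 Module.finrank_pos.ne'
  obtain ⟨c, hc⟩ : ∃ c : ℂ, ∑ x, ρ (x * y * x⁻¹) = c • (1 : Module.End ℂ V) := by
    refine exists_eq_smul_one_of_commute hρ fun g => ?_
    rw [Commute, SemiconjBy, Finset.sum_mul, Finset.mul_sum]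
    refine (Fintype.sum_equiv (Equiv.mulLeft g) _ _ fun x => ?_).symm
    rw [← map_mul, ← map_mul]
    simp [mul_assoc]
  have htrace : Fintype.card G * ρ.character y = c * Module.finrank ℂ V := by
    have h := congrArg (LinearMap.trace ℂ V) hc
    simp only [map_sum, map_smul, LinearMap.trace_one, smul_eq_mul] at h
    rw [← h, ← nsmul_eq_mul, ← Finset.card_univ, ← Finset.sum_const]
    exact Finset.sum_congr rfl fun x _ => (ρ.char_conj y x).symm
  rw [hc, htrace, mul_div_cancel_right₀ _ hn]

theorem trace_asAlgebraHom_commutatorSum (hρ : ρ.IsIrreducible) :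
    LinearMap.trace ℂ V (ρ.asAlgebraHom (commutatorSum G))
      = (Fintype.card G : ℂ) ^ 2 / Module.finrank ℂ V := by
  have hinner : ∑ y, ρ.character y * ρ.character y⁻¹ = Fintype.card G := by
    have h := Representation.card_inv_mul_sum_char_mul_char_eq_finrank ρ ρ
    rw [Representation.IsIrreducible.finrank_intertwiningMap_self, Nat.cast_one,
      inv_mul_eq_one₀ (Nat.cast_ne_zero.2 Nat.card_pos.ne'), Nat.card_eq_fintype_card] at h
    exact h.symm
  have hsum : ρ.asAlgebraHom (commutatorSum G) = ∑ y, (∑ x, ρ (x * y * x⁻¹)) * ρ y⁻¹ := by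
    simp only [commutatorSum, map_sum, Representation.asAlgebraHom_single_one,
      commutatorElement_def, Finset.sum_mul, ← map_mul]
    exact Finset.sum_comm
  simp only [hsum, sum_conj_eq_smul_one hρ, smul_mul_assoc, one_mul, map_sum, map_smul,
    smul_eq_mul, ← Representation.character.eq_1]
  simp only [mul_div_right_comm, mul_assoc, ← Finset.mul_sum, hinner]
  ring

theorem forall_eq_one_or_asAlgebraHom_subgroupAverage_eq_zero (hρ : ρ.IsIrreducible)
    (H : Subgroup G) [H.Normal] :
    (∀ h ∈ H, ρ h = 1) ∨ ρ.asAlgebraHom (subgroupAverage H) = 0 := by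
  obtain ⟨c, hc⟩ : ∃ c : ℂ, ρ.asAlgebraHom (subgroupAverage H) = c • (1 : Module.End ℂ V) := by
    refine exists_eq_smul_one_of_commute hρ fun g => ?_
    have h := (mem_center_monoidAlgebra_iff.1 (subgroupAverage_mem_center (H := H)) g)
    rw [← ρ.asAlgebraHom_single_one g]
    exact (Commute.map h.symm ρ.asAlgebraHom)
  refine or_iff_not_imp_right.2 fun hne h hh => ?_
  have hc0 : c ≠ 0 := by
    rintro rfl
    exact hne (by rw [hc, zero_smul])
  have hfix : ρ h * ρ.asAlgebraHom (subgroupAverage H) = ρ.asAlgebraHom (subgroupAverage H) := by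
    rw [← ρ.asAlgebraHom_single_one h, ← map_mul, single_mul_subgroupAverage hh]
  rw [hc, mul_smul_comm, mul_one] at hfix
  exact smul_right_injective _ hc0 hfix

theorem HasTwoDegreeCommutatorSum.finrank_eq (hG : HasTwoDegreeCommutatorSum G m)
    (hρ : ρ.IsIrreducible) (hlin : ¬ IsLinearCharacter ρ.character) :
    Module.finrank ℂ V = m := by
  have := nontrivial_of_isIrreducible hρ
  have hn : (Module.finrank ℂ V : ℂ) ≠ 0 := Nat.cast_ne_zero.2 Module.finrank_pos.ne'
  have hcard : (Fintype.card G : ℂ) ≠ 0 := Nat.cast_ne_zero.2 Fintype.card_ne_zero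
  rcases forall_eq_one_or_asAlgebraHom_subgroupAverage_eq_zero hρ (commutator G) with hone | hzero
  · refine absurd (isLinearCharacter_of_finrank_eq_one
      (finrank_eq_one_of_commute hρ fun g h => ?_)) hlin
    have hgh : ρ ⁅g, h⁆ = 1 :=
      hone _ (Subgroup.commutator_mem_commutator (Subgroup.mem_top g) (Subgroup.mem_top h))
    have hswap : g * h = ⁅g, h⁆ * (h * g) := by group
    rw [Commute, SemiconjBy, ← map_mul, hswap, map_mul, hgh, one_mul, map_mul]
  · have hscalar : ρ.asAlgebraHom (commutatorSum G)
        = (Fintype.card G : ℂ) ^ 2 • ((m : ℂ) ^ 2)⁻¹ • (1 : Module.End ℂ V) := by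
      rw [(hG : commutatorSum G = _)]
      simp only [map_smul, map_add, map_sub, map_one, hzero, zero_add, sub_zero]
    have htrace := trace_asAlgebraHom_commutatorSum hρ
    rw [hscalar, map_smul, map_smul, LinearMap.trace_one, smul_eq_mul, smul_eq_mul] at htrace
    have hm : (m : ℂ) ≠ 0 := fun hm =>
      div_ne_zero (pow_ne_zero 2 hcard) hn (by rw [← htrace, hm]; simp)
    field_simp at htrace
    exact Nat.pow_left_injective two_ne_zero (by exact_mod_cast htrace)

theorem HasTwoDegreeCommutatorSum.hasTwoCharacterDegrees (hG : HasTwoDegreeCommutatorSum G m)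
    (hcomm : ∃ a b : G, a * b ≠ b * a) : HasTwoCharacterDegrees G := by
  refine ⟨hcomm, ?_⟩
  rintro _ _ ⟨n, ρ, hρ, rfl⟩ ⟨k, σ, hσ, rfl⟩ hlin hlin'
  rw [Representation.char_one, Representation.char_one, hG.finrank_eq hρ hlin,
    hG.finrank_eq hσ hlin']

end Degrees

/-! ### Affine maps with restricted linear part -/

section AffineGroup

variable {F : Type*} [Field F]

/-- The affine map `x ↦ a x + b`, as the matrix `(a b; 0 1)`. -/
def affineMk (a : Fˣ) (b : F) : affineGroup F :=
  ⟨Matrix.GeneralLinearGroup.mkOfDetNeZero !![(a : F), b; 0, 1] (by simp), a, b, rfl⟩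

theorem coe_affineMk (a : Fˣ) (b : F) :
    ((affineMk a b : GL (Fin 2) F) : Matrix (Fin 2) (Fin 2) F) = !![(a : F), b; 0, 1] := rfl

theorem eq_affineMk_iff {g : affineGroup F} {a : Fˣ} {b : F} :
    g = affineMk a b ↔
      ((g : GL (Fin 2) F) : Matrix (Fin 2) (Fin 2) F) = !![(a : F), b; 0, 1] :=
  Subtype.ext_iff.trans Units.ext_iff

theorem affineMk_inj {a c : Fˣ} {b d : F} : affineMk a b = affineMk c d ↔ a = c ∧ b = d := by
  rw [eq_affineMk_iff, coe_affineMk, Units.ext_iff]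
  simp

theorem affineMk_mul_affineMk (a c : Fˣ) (b d : F) :
    affineMk a b * affineMk c d = affineMk (a * c) (a * d + b) := by
  rw [eq_affineMk_iff, Subgroup.coe_mul, Units.val_mul, coe_affineMk, coe_affineMk,
    Matrix.mul_fin_two]
  simp

theorem affineMk_one_zero : affineMk (1 : Fˣ) 0 = 1 :=
  (eq_affineMk_iff.2 (by simp [Matrix.one_fin_two])).symm

theorem affineMk_inv (a : Fˣ) (b : F) : (affineMk a b)⁻¹ = affineMk a⁻¹ (-(a⁻¹ * b)) := by
  rw [inv_eq_iff_mul_eq_one, affineMk_mul_affineMk, ← affineMk_one_zero]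
  simp

/-- The affine maps `x ↦ s x + b` with linear part `s` in a given subgroup `S` of `Fˣ`. -/
def affineSubgroup (S : Subgroup Fˣ) : Subgroup (affineGroup F) where
  carrier := {g | ∃ s ∈ S, ∃ b, g = affineMk s b}
  one_mem' := ⟨1, S.one_mem, 0, affineMk_one_zero.symm⟩
  mul_mem' := by
    rintro _ _ ⟨s, hs, b, rfl⟩ ⟨t, ht, c, rfl⟩
    exact ⟨s * t, S.mul_mem hs ht, _, affineMk_mul_affineMk s t b c⟩
  inv_mem' := by
    rintro _ ⟨s, hs, b, rfl⟩
    exact ⟨s⁻¹, S.inv_mem hs, _, affineMk_inv s b⟩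

theorem squareAffineGroup_eq_affineSubgroup :
    squareAffineGroup F = affineSubgroup (powMonoidHom 2 : Fˣ →* Fˣ).range := by
  ext g
  constructor
  · rintro ⟨a, b, hg⟩
    exact ⟨a ^ 2, ⟨a, rfl⟩, b, eq_affineMk_iff.2 (by rw [hg, Units.val_pow_eq_pow_val])⟩
  · rintro ⟨_, ⟨a, rfl⟩, b, rfl⟩
    exact ⟨a, b, by rw [coe_affineMk, powMonoidHom_apply, Units.val_pow_eq_pow_val]⟩

end AffineGroup

namespace affineSubgroup

variable {F : Type*} [Field F] {S : Subgroup Fˣ}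

/-- The element `x ↦ s x + b` of `affineSubgroup S`. -/
def mk (s : S) (b : F) : affineSubgroup S := ⟨affineMk s b, s, s.2, b, rfl⟩

theorem mk_inj {s t : S} {b c : F} : mk s b = mk t c ↔ s = t ∧ b = c := by
  rw [Subtype.ext_iff, Subtype.ext_iff (a1 := s)]
  exact affineMk_inj

theorem mk_mul_mk (s t : S) (b c : F) : mk s b * mk t c = mk (s * t) ((s : Fˣ) * c + b) := by
  rw [Subtype.ext_iff, Subgroup.coe_mul]
  exact affineMk_mul_affineMk (s : Fˣ) t b c

theorem mk_one_zero : mk (1 : S) 0 = 1 := Subtype.ext affineMk_one_zero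

theorem mk_injective (s : S) : Function.Injective (mk s) := fun _ _ h => (mk_inj.1 h).2

/-- The coordinates `(s, b)` of the map `x ↦ s x + b`. -/
noncomputable def equivProd (S : Subgroup Fˣ) : S × F ≃ affineSubgroup S :=
  Equiv.ofBijective (fun p => mk p.1 p.2) ⟨fun _ _ h => Prod.ext_iff.2 (mk_inj.1 h), by
    rintro ⟨_, s, hs, b, rfl⟩
    exact ⟨(⟨s, hs⟩, b), rfl⟩⟩

theorem equivProd_apply (p : S × F) : equivProd S p = mk p.1 p.2 := rfl

theorem exists_eq_mk (g : affineSubgroup S) : ∃ s b, g = mk s b :=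
  ⟨_, _, ((equivProd S).apply_symm_apply g).symm⟩

theorem sum_eq_sum_mk {M : Type*} [AddCommMonoid M] [Fintype F] [Fintype S]
    [Fintype (affineSubgroup S)] (f : affineSubgroup S → M) :
    ∑ g, f g = ∑ s, ∑ b, f (mk s b) := by
  rw [← Equiv.sum_comp (equivProd S), Fintype.sum_prod_type]
  simp only [equivProd_apply]

theorem card_eq (S : Subgroup Fˣ) : Nat.card (affineSubgroup S) = Nat.card S * Nat.card F := by
  rw [← Nat.card_prod, Nat.card_congr (equivProd S)]

theorem commutatorElement_mk (s t : S) (b c : F) :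
    ⁅mk s b, mk t c⁆ = mk 1 ((1 - (t : Fˣ)) * b + ((s : Fˣ) - 1) * c) := by
  rw [commutatorElement_def, mul_inv_eq_iff_eq_mul, mul_inv_eq_iff_eq_mul, mk_mul_mk, mk_mul_mk,
    mk_mul_mk, mk_inj]
  refine ⟨by simp [mul_comm], ?_⟩
  push_cast
  ring

theorem conj_mk (s t : S) (b c : F) :
    mk t c * mk s b * (mk t c)⁻¹ = mk s ((1 - (s : Fˣ)) * c + (t : Fˣ) * b) := by
  rw [mul_inv_eq_iff_eq_mul, mk_mul_mk, mk_mul_mk, mk_inj]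
  refine ⟨mul_comm _ _, ?_⟩
  ring

/-- The homomorphism sending `x ↦ s x + b` to `s`. -/
noncomputable def linearPart (S : Subgroup Fˣ) : affineSubgroup S →* S :=
  MonoidHom.mk' (fun g => ((equivProd S).symm g).1) fun g h => by
    obtain ⟨s, b, rfl⟩ := exists_eq_mk g
    obtain ⟨t, c, rfl⟩ := exists_eq_mk h
    rw [mk_mul_mk]
    simp only [← equivProd_apply (_, _), Equiv.symm_apply_apply]

theorem linearPart_mk (s : S) (b : F) : linearPart S (mk s b) = s :=
  congrArg Prod.fst ((equivProd S).symm_apply_apply (s, b))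

theorem one_sub_coe_ne_zero {s : S} (hs : s ≠ 1) : 1 - ((s : Fˣ) : F) ≠ 0 :=
  sub_ne_zero_of_ne fun h => hs (Subtype.ext (Units.ext h.symm))

theorem mk_mem_commutator_iff [Nontrivial S] {s : S} {b : F} :
    mk s b ∈ commutator (affineSubgroup S) ↔ s = 1 := by
  constructor
  · intro h
    rw [← linearPart_mk s b]
    exact Abelianization.commutator_subset_ker (linearPart S) h
  · rintro rfl
    obtain ⟨t, ht⟩ := exists_ne (1 : S)
    have hcomm : mk (1 : S) b = ⁅mk (1 : S) ((1 - ((t : Fˣ) : F))⁻¹ * b), mk t 0⁆ := by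
      rw [commutatorElement_mk, mul_inv_cancel_left₀ (one_sub_coe_ne_zero ht), mul_zero, add_zero]
    rw [hcomm]
    exact Subgroup.commutator_mem_commutator (Subgroup.mem_top _) (Subgroup.mem_top _)

theorem coe_commutator (S : Subgroup Fˣ) [Nontrivial S] :
    (commutator (affineSubgroup S) : Set (affineSubgroup S)) = Set.range (mk (1 : S)) := by
  ext g
  obtain ⟨s, b, rfl⟩ := exists_eq_mk g
  simp [mk_mem_commutator_iff, mk_inj, eq_comm]

theorem card_commutator (S : Subgroup Fˣ) [Nontrivial S] :
    Nat.card (commutator (affineSubgroup S)) = Nat.card F := by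
  rw [← SetLike.coe_sort_coe, coe_commutator, Nat.card_range_of_injective (mk_injective 1)]

theorem sum_sum_mul_add_mul {M : Type*} [AddCommMonoid M] [Fintype F] {α β : F}
    (h : α ≠ 0 ∨ β ≠ 0) (f : F → M) :
    ∑ b, ∑ c, f (α * b + β * c) = Fintype.card F • ∑ d, f d := by
  have key {γ : F} (hγ : γ ≠ 0) (e : F) : ∑ c, f (γ * c + e) = ∑ d, f d :=
    Fintype.sum_equiv ((Equiv.mulLeft₀ γ hγ).trans (Equiv.addRight e)) _ _ fun _ => rfl
  rcases h with h | h
  · rw [Finset.sum_comm, Finset.sum_congr rfl fun c _ => key h (β * c), Finset.sum_const,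
      Finset.card_univ]
  · simp only [add_comm (α * _), key h, Finset.sum_const, Finset.card_univ]

/-- The sum of the translations in the group algebra of `affineSubgroup S`. -/
noncomputable def translationSum [Fintype F] (S : Subgroup Fˣ) :
    MonoidAlgebra ℂ (affineSubgroup S) :=
  ∑ d, MonoidAlgebra.single (mk 1 d) 1

theorem subgroupAverage_commutator [Fintype F] [Fintype (affineSubgroup S)] [Nontrivial S] :
    subgroupAverage (commutator (affineSubgroup S))
      = (Fintype.card F : ℂ)⁻¹ • translationSum S := by
  classical
  have := Fintype.ofFinite S
  have hweight (s : S) (b : F) :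
      uniformWeight (commutator (affineSubgroup S) : Set (affineSubgroup S)) (mk s b)
        = if s = 1 then (Fintype.card F : ℝ)⁻¹ else 0 := by
    simp only [uniformWeight, Set.indicator_apply, SetLike.mem_coe, mk_mem_commutator_iff]
    rw [← Nat.card_coe_set_eq, SetLike.coe_sort_coe, card_commutator, Nat.card_eq_fintype_card]
  rw [subgroupAverage, sum_eq_sum_mk, Fintype.sum_eq_single 1, translationSum, Finset.smul_sum]
  · simp [hweight]
  · intro s hs
    simp [hweight, hs]

theorem sum_sum_single_commutatorElement_one [Fintype F] :
    ∑ b, ∑ c, MonoidAlgebra.single ⁅mk (1 : S) b, mk 1 c⁆ (1 : ℂ)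
      = (Fintype.card F : ℂ) ^ 2 • (1 : MonoidAlgebra ℂ (affineSubgroup S)) := by
  simp [commutatorElement_mk, mk_one_zero, ← MonoidAlgebra.one_def, sq, mul_smul,
    ← Nat.cast_smul_eq_nsmul ℂ]

theorem sum_sum_single_commutatorElement [Fintype F] {s t : S} (hst : s ≠ 1 ∨ t ≠ 1) :
    ∑ b, ∑ c, MonoidAlgebra.single ⁅mk s b, mk t c⁆ (1 : ℂ)
      = (Fintype.card F : ℂ) • translationSum S := by
  have hne : 1 - ((t : Fˣ) : F) ≠ 0 ∨ ((s : Fˣ) : F) - 1 ≠ 0 := by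
    rw [← neg_sub 1 ((s : Fˣ) : F), neg_ne_zero]
    exact hst.symm.imp one_sub_coe_ne_zero one_sub_coe_ne_zero
  simp only [commutatorElement_mk]
  rw [sum_sum_mul_add_mul hne fun d => MonoidAlgebra.single (mk (1 : S) d) (1 : ℂ),
    translationSum, Nat.cast_smul_eq_nsmul]

theorem commutatorSum_eq [Fintype F] [Fintype S] [Fintype (affineSubgroup S)] :
    commutatorSum (affineSubgroup S)
      = (Fintype.card F : ℂ) ^ 2 • (1 : MonoidAlgebra ℂ (affineSubgroup S))
        + (((Fintype.card S : ℂ) ^ 2 - 1) * Fintype.card F) • translationSum S := by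
  classical
  have hterm : ∀ p ∈ ({(1, 1)}ᶜ : Finset (S × S)),
      ∑ b, ∑ c, MonoidAlgebra.single ⁅mk p.1 b, mk p.2 c⁆ (1 : ℂ)
        = (Fintype.card F : ℂ) • translationSum S := fun p hp =>
    sum_sum_single_commutatorElement (not_and_or.1 (by simpa [Prod.ext_iff] using hp))
  simp only [commutatorSum, sum_eq_sum_mk]
  rw [Finset.sum_congr rfl fun s _ => Finset.sum_comm, ← Fintype.sum_prod_type',
    Fintype.sum_eq_add_sum_compl (1, 1), Finset.sum_congr rfl hterm,
    sum_sum_single_commutatorElement_one, Finset.sum_const, Finset.card_compl,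
    Finset.card_singleton, ← Nat.cast_smul_eq_nsmul ℂ, Nat.cast_pred Fintype.card_pos,
    Fintype.card_prod, smul_smul, Nat.cast_mul, ← sq]

theorem hasTwoDegreeCommutatorSum (S : Subgroup Fˣ) [Finite F] [Nontrivial S]
    [Fintype (affineSubgroup S)] : HasTwoDegreeCommutatorSum (affineSubgroup S) (Nat.card S) := by
  have := Fintype.ofFinite F
  have := Fintype.ofFinite S
  have hF : (Fintype.card F : ℂ) ≠ 0 := Nat.cast_ne_zero.2 Fintype.card_ne_zero
  have hS : (Fintype.card S : ℂ) ≠ 0 := Nat.cast_ne_zero.2 Fintype.card_ne_zero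
  have hcard : Fintype.card (affineSubgroup S) = Fintype.card S * Fintype.card F := by
    simpa only [Nat.card_eq_fintype_card] using card_eq S
  rw [HasTwoDegreeCommutatorSum, commutatorSum_eq, subgroupAverage_commutator, hcard,
    Nat.card_eq_fintype_card]
  push_cast
  match_scalars <;> field_simp
  ring

theorem conjugatesOf_mk_of_ne_one {s : S} (hs : s ≠ 1) (b : F) :
    conjugatesOf (mk s b) = Set.range (mk s) := by
  ext g
  constructor
  · intro h
    obtain ⟨x, rfl⟩ := isConj_iff.1 h
    obtain ⟨t, c, rfl⟩ := exists_eq_mk x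
    exact ⟨_, (conj_mk s t b c).symm⟩
  · rintro ⟨d, rfl⟩
    refine isConj_iff.2 ⟨mk 1 ((1 - ((s : Fˣ) : F))⁻¹ * (d - b)), ?_⟩
    rw [conj_mk, mul_inv_cancel_left₀ (one_sub_coe_ne_zero hs)]
    simp

theorem conjugatesOf_mk_one (b : F) :
    conjugatesOf (mk (1 : S) b) = Set.range fun t : S => mk (1 : S) ((t : Fˣ) * b) := by
  ext g
  constructor
  · intro h
    obtain ⟨x, rfl⟩ := isConj_iff.1 h
    obtain ⟨t, c, rfl⟩ := exists_eq_mk x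
    exact ⟨t, by simp [conj_mk]⟩
  · rintro ⟨t, rfl⟩
    exact isConj_iff.2 ⟨mk t 0, by simp [conj_mk]⟩

theorem ncard_conjugatesOf_mk_of_ne_one {s : S} (hs : s ≠ 1) (b : F) :
    (conjugatesOf (mk s b)).ncard = Nat.card F := by
  rw [conjugatesOf_mk_of_ne_one hs, Set.ncard_range_of_injective (mk_injective s)]

theorem ncard_conjugatesOf_mk_one {b : F} (hb : b ≠ 0) :
    (conjugatesOf (mk (1 : S) b)).ncard = Nat.card S := by
  rw [conjugatesOf_mk_one, Set.ncard_range_of_injective fun t u h =>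
    Subtype.ext (Units.ext (mul_right_cancel₀ hb (mk_inj.1 h).2))]

theorem sum_ncard_conjugatesOf [Finite F] [Fintype (affineSubgroup S)] :
    ∑ g : affineSubgroup S, (conjugatesOf g).ncard
      = 1 + (Nat.card F - 1) * Nat.card S + (Nat.card S - 1) * Nat.card F ^ 2 := by
  classical
  have := Fintype.ofFinite F
  have := Fintype.ofFinite S
  have hzero : conjugatesOf (mk (1 : S) 0) = {1} := by
    rw [conjugatesOf_mk_one]
    simp [mk_one_zero]
  rw [sum_eq_sum_mk, Fintype.sum_eq_add_sum_compl 1, Fintype.sum_eq_add_sum_compl (0 : F), hzero,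
    Set.ncard_singleton]
  congr 2
  · rw [Finset.sum_congr rfl fun b hb => ncard_conjugatesOf_mk_one (by simpa using hb)]
    simp [Finset.card_compl]
  · rw [Finset.sum_congr rfl fun s hs => Finset.sum_congr rfl fun b _ =>
      ncard_conjugatesOf_mk_of_ne_one (by simpa using hs) b]
    simp [Finset.card_compl, sq]

theorem zlAmenabilityConstant_eq (S : Subgroup Fˣ) [Finite F] [Nontrivial S] :
    zlAmenabilityConstant (affineSubgroup S)
      = 1 + 2 * ((Nat.card S : ℝ) ^ 2 - 1) * ((Nat.card F - 1) * (Nat.card F + 1 - Nat.card S))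
          / (Nat.card F ^ 2 * Nat.card S) := by
  have := Fintype.ofFinite (affineSubgroup S)
  have hF : (Nat.card F : ℝ) ≠ 0 := Nat.cast_ne_zero.2 Nat.card_pos.ne'
  have hS : (Nat.card S : ℝ) ≠ 0 := Nat.cast_ne_zero.2 Nat.card_pos.ne'
  rw [(hasTwoDegreeCommutatorSum S).zlAmenabilityConstant_eq Nat.card_pos.ne',
    sum_ncard_conjugatesOf, card_eq, card_commutator]
  push_cast [Nat.cast_sub Nat.card_pos]
  field_simp
  ring

theorem hasTwoCharacterDegrees (S : Subgroup Fˣ) [Finite F] [Nontrivial S] :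
    HasTwoCharacterDegrees (affineSubgroup S) := by
  have := Fintype.ofFinite (affineSubgroup S)
  refine (hasTwoDegreeCommutatorSum S).hasTwoCharacterDegrees ?_
  obtain ⟨s, hs⟩ := exists_ne (1 : S)
  refine ⟨mk s 0, mk 1 1, fun h => hs ?_⟩
  simpa [mk_mul_mk, mk_inj] using h

end affineSubgroup

theorem two_mul_card_range_powMonoidHom_add_one {F : Type*} [Field F] [Finite F]
    (hF : Odd (Nat.card F)) : 2 * Nat.card (powMonoidHom 2 : Fˣ →* Fˣ).range + 1 = Nat.card F := by
  have hunits : Nat.card Fˣ = Nat.card F - 1 := Nat.card_units F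
  have hindex : (powMonoidHom 2 : Fˣ →* Fˣ).range.index = 2 := by
    rw [IsCyclic.index_powMonoidHom_range, hunits]
    exact Nat.gcd_eq_right (Nat.Odd.sub_odd hF odd_one).two_dvd
  have := (powMonoidHom 2 : Fˣ →* Fˣ).range.card_mul_index
  have := Nat.card_pos (α := F)
  rw [hindex] at *
  omega

theorem nontrivial_range_powMonoidHom_two {F : Type*} [Field F] [Finite F]
    (hF : Odd (Nat.card F)) (h5 : 5 ≤ Nat.card F) :
    Nontrivial (powMonoidHom 2 : Fˣ →* Fˣ).range := by
  have := two_mul_card_range_powMonoidHom_add_one hF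
  exact Finite.one_lt_card_iff_nontrivial.1 (by omega)

theorem hasTwoCharacterDegrees_squareAffineGroup {F : Type*} [Field F] [Finite F]
    (hF : Odd (Nat.card F)) (h5 : 5 ≤ Nat.card F) :
    HasTwoCharacterDegrees (squareAffineGroup F) := by
  have := nontrivial_range_powMonoidHom_two hF h5
  rw [squareAffineGroup_eq_affineSubgroup]
  exact affineSubgroup.hasTwoCharacterDegrees _

theorem zlAmenabilityConstant_squareAffineGroup {F : Type*} [Field F] [Finite F]
    (hF : Odd (Nat.card F)) (h5 : 5 ≤ Nat.card F) :
    zlAmenabilityConstant (squareAffineGroup F)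
      = 1 + ((Nat.card F : ℝ) + 1) / 2 * (1 - 9 / (Nat.card F : ℝ) ^ 2) := by
  have := nontrivial_range_powMonoidHom_two hF h5
  have hcard : (Nat.card F : ℝ) = 2 * Nat.card (powMonoidHom 2 : Fˣ →* Fˣ).range + 1 := by
    exact_mod_cast (two_mul_card_range_powMonoidHom_add_one hF).symm
  have hS : (Nat.card (powMonoidHom 2 : Fˣ →* Fˣ).range : ℝ) ≠ 0 :=
    Nat.cast_ne_zero.2 Nat.card_pos.ne'
  rw [squareAffineGroup_eq_affineSubgroup, affineSubgroup.zlAmenabilityConstant_eq, hcard]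
  field_simp
  ring

theorem lt_one_add_mul_of_four_mul_lt {C x : ℝ} (hx : 5 ≤ x) (hC : 4 * C < x) :
    C < 1 + (x + 1) / 2 * (1 - 9 / x ^ 2) := by
  have hhalf : 9 / x ^ 2 ≤ 1 / 2 := by
    rw [div_le_div_iff₀ (by positivity) two_pos]
    nlinarith
  nlinarith

theorem mainTheorem8 :
    (∀ (F : Type*) [Field F] [Finite F] (q : ℕ), Nat.card F = q → Odd q → 5 ≤ q →
      HasTwoCharacterDegrees (squareAffineGroup F) ∧
      zlAmenabilityConstant (squareAffineGroup F)
        = 1 + ((q : ℝ) + 1) / 2 * (1 - 9 / (q : ℝ) ^ 2)) ∧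
    (∀ C : ℝ, ∃ (G : Type) (_ : Group G) (_ : Finite G),
      HasTwoCharacterDegrees G ∧ C < zlAmenabilityConstant G) := by
  refine ⟨?_, fun C => ?_⟩
  · rintro F _ _ _ rfl hodd h5
    exact ⟨hasTwoCharacterDegrees_squareAffineGroup hodd h5,
      zlAmenabilityConstant_squareAffineGroup hodd h5⟩
  · obtain ⟨n, hn⟩ := exists_nat_gt (4 * C)
    obtain ⟨p, hp, hprime⟩ := Nat.exists_infinite_primes (max n 5)
    have := Fact.mk hprime
    rw [max_le_iff, ← Nat.card_zmod p] at hp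
    have hodd : Odd (Nat.card (ZMod p)) := by
      rw [Nat.card_zmod] at hp ⊢
      exact hprime.odd_of_ne_two (by omega)
    refine ⟨squareAffineGroup (ZMod p), inferInstance, inferInstance,
      hasTwoCharacterDegrees_squareAffineGroup hodd hp.2, ?_⟩
    rw [zlAmenabilityConstant_squareAffineGroup hodd hp.2]
    exact lt_one_add_mul_of_four_mul_lt (by exact_mod_cast hp.2) (hn.trans_le (Nat.cast_le.2 hp.1))
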